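/- Let $F_N$ be the free group of rank $N$, and let $\mathrm{cv}_N$ be the (unprojectivized) Culler--Vogtmann outer space: the set of free, minimal, discrete, isometric actions of $F_N$ on $\mathbb{R}$-trees, two actions $T_1,T_2$ being identified when there is an $F_N$-equivariant isometry of $T_1$ onto $T_2$. For $T\in \mathrm{cv}_N$ and $g\in F_N$ let $\|g\|_T=\inf_{x\in T} d(x,gx)$. A subset $\Sigma\subseteq F_N$ is \emph{spectrally rigid} if, whenever $T_1,T_2\in \mathrm{cv}_N$ satisfy $\|\sigma\|_{T_1}=\|\sigma\|_{T_2}$ for all $\sigma\in\Sigma$, then $T_1=T_2$ in $\mathrm{cv}_N$. A subset $\Sigma\subseteq F_2$ has \emph{property $\mathcal{W}^*$} if there are a free basis $\{a,b\}$ of $F_2$ and an integer $k\ge 1$ such that for every $\sigma\in\Sigma$, writing $[[\sigma]]$ for the cyclically reduced cyclic word that represents the conjugacy class of $\sigma$ over the free basis $\{a,\,ba^k\}$: (1) $[[\sigma]]$ is not a power $(ba^k)^t$ with $t\in\mathbb{Z}$ (in particular $\sigma\neq 1$); and (2) if $t$ is a nonzero integer and $(ba^k)^t$, as a word in the letter $ba^k$,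 is a subword of the cyclic word $[[\sigma]]$, then $t=\pm1$. Proposition. If $\Sigma\subseteq F_2$ has property $\mathcal{W}^*$, then $\Sigma$ is not spectrally rigid. -/

import Mathlib

/-- An `ℝ`-tree: a nonempty geodesic metric space that is `0`-hyperbolic (four-point condition). -/
structure IsRTree (T : Type) [MetricSpace T] : Prop where
  nonempty : Nonempty T
  geodesic : ∀ x y : T, ∃ γ : ℝ → T, γ 0 = x ∧ γ (dist x y) = y ∧
    ∀ s ∈ Set.Icc 0 (dist x y), ∀ t ∈ Set.Icc 0 (dist x y), dist (γ s) (γ t) = |s - t|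
  four_point : ∀ x y z w : T,
    dist x y + dist z w ≤ max (dist x z + dist y w) (dist x w + dist y z)

/-- A subtree: a nonempty subset containing, with any two of its points, the segment between
them. (In an `ℝ`-tree the segment `[x, y]` is the set of `z` with `d(x,z) + d(z,y) = d(x,y)`.) -/
def IsSubtree {T : Type} [MetricSpace T] (S : Set T) : Prop :=
  S.Nonempty ∧ ∀ x ∈ S, ∀ y ∈ S, ∀ z : T, dist x z + dist z y = dist x y → z ∈ S

/-- A free, minimal, discrete, isometric action of the free group `F_N` on an `ℝ`-tree. -/
structure TreeAction (N : ℕ) where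
  /-- the underlying tree -/
  carrier : Type
  [metric : MetricSpace carrier]
  [action : MulAction (FreeGroup (Fin N)) carrier]
  isRTree : IsRTree carrier
  isometric : ∀ g : FreeGroup (Fin N), ∀ x y : carrier, dist (g • x) (g • y) = dist x y
  free : ∀ (g : FreeGroup (Fin N)) (x : carrier), g • x = x → g = 1
  minimal : ∀ S : Set carrier, IsSubtree S →
    (∀ g : FreeGroup (Fin N), ∀ x ∈ S, g • x ∈ S) → S = Set.univ
  discrete : ∀ x : carrier, DiscreteTopology (MulAction.orbit (FreeGroup (Fin N)) x)

attribute [instance] TreeAction.metric TreeAction.action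

/-- Two actions are equivalent if there is an equivariant (surjective) isometry between the
trees. -/
def TreeAction.Equivalent {N : ℕ} (T₁ T₂ : TreeAction N) : Prop :=
  ∃ f : T₁.carrier ≃ᵢ T₂.carrier,
    ∀ (g : FreeGroup (Fin N)) (x : T₁.carrier), f (g • x) = g • f x

instance TreeAction.setoid (N : ℕ) : Setoid (TreeAction N) where
  r := TreeAction.Equivalent
  iseqv :=
    { refl := fun T => ⟨IsometryEquiv.refl _, fun _ _ => rfl⟩
      symm := by
        rintro T₁ T₂ ⟨f, hf⟩
        refine ⟨f.symm, fun g x => f.injective ?_⟩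
        rw [hf, f.apply_symm_apply, f.apply_symm_apply]
      trans := by
        rintro T₁ T₂ T₃ ⟨f, hf⟩ ⟨h, hh⟩
        refine ⟨f.trans h, fun g x => ?_⟩
        simp [hf, hh] }

/-- Unprojectivized Culler–Vogtmann outer space `cv_N`. -/
def OuterSpace (N : ℕ) : Type 1 := Quotient (TreeAction.setoid N)

/-- The translation length `‖g‖_T = inf {d(x, g x) : x ∈ T}` of an action. -/
noncomputable def TreeAction.translationLength {N : ℕ} (T : TreeAction N)
    (g : FreeGroup (Fin N)) : ℝ :=
  ⨅ x : T.carrier, dist x (g • x)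

theorem TreeAction.translationLength_congr {N : ℕ} (T₁ T₂ : TreeAction N)
    (h : T₁.Equivalent T₂) : T₁.translationLength = T₂.translationLength := by
  obtain ⟨f, hf⟩ := h
  funext g
  refine f.toEquiv.iInf_congr fun x => ?_
  change dist (f x) (g • f x) = dist x (g • x)
  rw [← hf, f.dist_eq]

/-- The translation length function of a point of `cv_N`. -/
noncomputable def OuterSpace.translationLength {N : ℕ} (T : OuterSpace N) :
    FreeGroup (Fin N) → ℝ :=
  Quotient.lift TreeAction.translationLength TreeAction.translationLength_congr T

/-- `Σ ⊆ F_N` is spectrally rigid if a point of `cv_N` is determined by the translation lengths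
of the elements of `Σ`. -/
def SpectrallyRigid {N : ℕ} (S : Set (FreeGroup (Fin N))) : Prop :=
  ∀ T₁ T₂ : OuterSpace N,
    (∀ g ∈ S, T₁.translationLength g = T₂.translationLength g) → T₁ = T₂

/-- The automorphism of `F(x₀, x₁)` with `x₀ ↦ x₀`, `x₁ ↦ x₁ x₀ ^ k`. -/
def twistAut (k : ℤ) : FreeGroup (Fin 2) ≃* FreeGroup (Fin 2) :=
  MonoidHom.toMulEquiv
    (FreeGroup.lift ![FreeGroup.of 0, FreeGroup.of 1 * FreeGroup.of 0 ^ k])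
    (FreeGroup.lift ![FreeGroup.of 0, FreeGroup.of 1 * FreeGroup.of 0 ^ (-k)])
    (by ext i; fin_cases i <;> simp)
    (by ext i; fin_cases i <;> simp)

/-- For a free basis `{a, b}` of `F_2`, the free basis `{a, b a ^ k}`. -/
def twistBasis (B : FreeGroupBasis (Fin 2) (FreeGroup (Fin 2))) (k : ℤ) :
    FreeGroupBasis (Fin 2) (FreeGroup (Fin 2)) :=
  FreeGroupBasis.ofRepr (B.repr.trans (twistAut k).symm)

theorem twistBasis_zero (B : FreeGroupBasis (Fin 2) (FreeGroup (Fin 2))) (k : ℤ) :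
    twistBasis B k 0 = B 0 := by
  change B.repr.symm (twistAut k (FreeGroup.of 0)) = B.repr.symm (FreeGroup.of 0)
  simp [twistAut]

theorem twistBasis_one (B : FreeGroupBasis (Fin 2) (FreeGroup (Fin 2))) (k : ℤ) :
    twistBasis B k 1 = B 1 * B 0 ^ k := by
  change B.repr.symm (twistAut k (FreeGroup.of 1)) =
    B.repr.symm (FreeGroup.of 1) * B.repr.symm (FreeGroup.of 0) ^ k
  simp [twistAut]

/-- A cyclically reduced word over the basis `C` representing the conjugacy class of `σ`; it is
the cyclic word `[[σ]]_C`, up to cyclic permutation. -/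
def cyclicWord {N : ℕ} (C : FreeGroupBasis (Fin N) (FreeGroup (Fin N)))
    (σ : FreeGroup (Fin N)) : List (Fin N × Bool) :=
  FreeGroup.reduceCyclically (C.repr σ).toWord

/-- `u` is a (nondegenerate) subword of the cyclic word represented by `w`. -/
def IsCyclicSubword {N : ℕ} (u w : List (Fin N × Bool)) : Prop :=
  u ≠ [] ∧ ∃ w' : List (Fin N × Bool), w' ~r w ∧ u <:+: w'

/-- Property `𝒲*` for `Σ ⊆ F_2`: for some free basis `{a, b}` and some `k ≥ 1`, for every `σ ∈ Σ`
the cyclically reduced form of `σ` over `{a, b a ^ k}` does not lie in `⟨b a ^ k⟩`, and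
the only powers of the letter `b a ^ k` occurring in it as cyclic subwords are `(b a ^ k) ^ (±1)`. -/
def PropertyWStar (S : Set (FreeGroup (Fin 2))) : Prop :=
  ∃ (B : FreeGroupBasis (Fin 2) (FreeGroup (Fin 2))) (k : ℕ), 1 ≤ k ∧ ∀ σ ∈ S,
    FreeGroup.mk (cyclicWord (twistBasis B k) σ) ∉
      Subgroup.zpowers (FreeGroup.of (1 : Fin 2)) ∧
    ∀ t : ℤ, IsCyclicSubword (FreeGroup.toWord (FreeGroup.of (1 : Fin 2) ^ t))
      (cyclicWord (twistBasis B k) σ) → t = 1 ∨ t = -1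

/-! Write `x₀ = a` and `x₁ = ba^k`. Pull back the Cayley tree of `F₂` along two injective
endomorphisms: the rose `x₀ ↦ x₀, x₁ ↦ x₁³` and the barbell `x₀ ↦ x₀, x₁ ↦ x₁x₀x₁⁻¹`. The
restrictions to minimal subtrees are two points of outer space. Both maps replace `x₀` by a word of
length 1 and `x₁` by a word of length 3. Property `𝒲*` says that no two cyclically consecutive
letters of `[[σ]]` are `x₁^{±1}`. For such a word neither substitution causes cancellation, so both
translation lengths count 1 for each `x₀^{±1}` and 3 for each `x₁^{±1}`. On `x₁` itself the lengths
are 3 and 1, so the trees differ.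

The Cayley tree is the tight span of the free group with its word metric, which fills in the edges
(`TightSpan.isRTree`). Every length comes from an axis: `exists_isAxisPoint` finds one from a
cyclically reduced word, and `IsAxisPoint.mem_of_isSubtree` keeps it in the minimal subtree. The
combinatorial core is `isCyclicallyReduced_substWord` with `isChain_noSquareStep_of_cyclicSubwords`.
-/

/-! ### The tight span of a metric space -/

/-- The functions forming the tight span of `X`: `f x + f y` bounds the distance from above, and
no value of `f` can be lowered. -/
def IsExtremal {X : Type} [MetricSpace X] (f : X → ℝ) : Prop :=
  (∀ x y, dist x y ≤ f x + f y) ∧ ∀ x, ∀ ε > 0, ∃ y, f x + f y ≤ dist x y + ε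

/-- The tight span (injective hull) of `X`. -/
def TightSpan (X : Type) [MetricSpace X] : Type := {f : X → ℝ // IsExtremal f}

namespace TightSpan

variable {X : Type} [MetricSpace X]

instance : CoeFun (TightSpan X) fun _ => X → ℝ := ⟨Subtype.val⟩

@[ext] theorem ext {f g : TightSpan X} (h : ∀ x, f x = g x) : f = g :=
  Subtype.ext (funext h)

theorem dist_le_add (f : TightSpan X) (x y : X) : dist x y ≤ f x + f y := f.2.1 x y

theorem exists_add_le (f : TightSpan X) (x : X) {ε : ℝ} (hε : 0 < ε) :
    ∃ y, f x + f y ≤ dist x y + ε := f.2.2 x ε hε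

theorem apply_nonneg (f : TightSpan X) (x : X) : 0 ≤ f x := by
  have := f.dist_le_add x x
  rw [dist_self] at this
  linarith

theorem apply_le (f : TightSpan X) (x y : X) : f x ≤ dist x y + f y := by
  refine le_of_forall_pos_le_add fun ε hε => ?_
  obtain ⟨w, hw⟩ := f.exists_add_le x hε
  have h₁ := dist_triangle x y w
  have h₂ := f.dist_le_add y w
  linarith

noncomputable instance : Dist (TightSpan X) := ⟨fun f g => ⨆ x, |f x - g x|⟩

theorem dist_def (f g : TightSpan X) : dist f g = ⨆ x, |f x - g x| := rfl

theorem bddAbove_range_abs_sub (f g : TightSpan X) :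
    BddAbove (Set.range fun x => |f x - g x|) := by
  rcases isEmpty_or_nonempty X with h | ⟨⟨o⟩⟩
  · simp [Set.range_eq_empty]
  · refine ⟨f o + g o, ?_⟩
    rintro _ ⟨x, rfl⟩
    have h₁ := f.apply_le x o
    have h₂ := g.apply_le x o
    have h₃ := f.dist_le_add x o
    have h₄ := g.dist_le_add x o
    exact abs_sub_le_iff.2 ⟨by linarith, by linarith⟩

theorem abs_sub_le_dist (f g : TightSpan X) (x : X) : |f x - g x| ≤ dist f g :=
  le_ciSup (bddAbove_range_abs_sub f g) x

theorem dist_le_add_add_dist (f g : TightSpan X) (x y : X) :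
    dist x y ≤ f x + g y + dist f g := by
  have h₁ := f.dist_le_add x y
  have h₂ := (abs_le.1 (abs_sub_le_dist f g y)).2
  linarith

/-- The canonical embedding of a metric space in its tight span. -/
def of (x : X) : TightSpan X :=
  ⟨fun y => dist x y, fun y z => dist_triangle_left y z x,
    fun y ε hε => ⟨x, by simp [dist_comm, hε.le]⟩⟩

theorem of_apply (x y : X) : of x y = dist x y := rfl

section Nonempty

variable [Nonempty X]

theorem dist_le_of_forall_abs_sub_le {f g : TightSpan X} {c : ℝ} (h : ∀ x, |f x - g x| ≤ c) :
    dist f g ≤ c := ciSup_le h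

noncomputable instance : MetricSpace (TightSpan X) where
  dist_self f := by simp [dist_def]
  dist_comm f g := by simp [dist_def, abs_sub_comm]
  dist_triangle f g h := dist_le_of_forall_abs_sub_le fun x =>
    (abs_sub_le _ (g x) _).trans (add_le_add (abs_sub_le_dist f g x) (abs_sub_le_dist g h x))
  eq_of_dist_eq_zero {f g} h := by
    ext x
    have := abs_sub_le_dist f g x
    rw [h] at this
    exact sub_eq_zero.1 (abs_nonpos_iff.1 this)

theorem dist_le_of_forall_dist_le {f g : TightSpan X} {c : ℝ}
    (h : ∀ x y, dist x y ≤ f x + g y + c) : dist f g ≤ c := by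
  refine dist_le_of_forall_abs_sub_le fun x => abs_sub_le_iff.2 ⟨?_, ?_⟩
  · refine le_of_forall_pos_le_add fun ε hε => ?_
    obtain ⟨y, hy⟩ := f.exists_add_le x hε
    have := h y x
    rw [dist_comm] at this
    linarith
  · refine le_of_forall_pos_le_add fun ε hε => ?_
    obtain ⟨y, hy⟩ := g.exists_add_le x hε
    have := h x y
    linarith

/-- By extremality, `dist f g` is the supremum of `dist x y - f x - g y`. This turns inequalities in
`X` into inequalities in the tight span. -/
theorem exists_dist_le (f g : TightSpan X) {ε : ℝ} (hε : 0 < ε) :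
    ∃ x y, dist f g ≤ dist x y - f x - g y + ε := by
  by_contra! h
  have : dist f g ≤ dist f g - ε := dist_le_of_forall_dist_le fun x y => by linarith [h x y]
  linarith

theorem dist_of_left (x : X) (f : TightSpan X) : dist (of x) f = f x := by
  refine le_antisymm (dist_le_of_forall_abs_sub_le fun y => ?_) ?_
  · have h₁ := f.dist_le_add x y
    have h₂ := f.apply_le y x
    rw [dist_comm] at h₂
    exact abs_sub_le_iff.2 ⟨by rw [of_apply]; linarith, by rw [of_apply]; linarith⟩
  · have := abs_sub_le_dist (of x) f x
    rwa [of_apply, dist_self, zero_sub, abs_neg, abs_of_nonneg (f.apply_nonneg x)] at this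

theorem dist_of_of (x y : X) : dist (of x) (of y) = dist x y := by
  rw [dist_of_left, of_apply, dist_comm]

theorem four_point (hX : ∀ x y z w : X,
      dist x y + dist z w ≤ max (dist x z + dist y w) (dist x w + dist y z))
    (f g h k : TightSpan X) :
    dist f g + dist h k ≤ max (dist f h + dist g k) (dist f k + dist g h) := by
  refine le_of_forall_pos_le_add fun ε hε => ?_
  obtain ⟨x, y, hxy⟩ := exists_dist_le f g (half_pos hε)
  obtain ⟨z, w, hzw⟩ := exists_dist_le h k (half_pos hε)
  rw [← max_add_add_right, le_max_iff]
  rcases le_max_iff.1 (hX x y z w) with H | H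
  · left
    linarith [dist_le_add_add_dist f h x z, dist_le_add_add_dist g k y w]
  · right
    linarith [dist_le_add_add_dist f k x w, dist_le_add_add_dist g h y z]

/-- In a tree, the point at distance `s` from `f` and `t` from `g` on their segment has distance
`max (f x - s) (g x - t)` from `x`. This supplies the points of geodesics. -/
theorem isExtremal_max_sub (hX : ∀ x y z w : X,
      dist x y + dist z w ≤ max (dist x z + dist y w) (dist x w + dist y z))
    (f g : TightSpan X) {s t : ℝ} (hs : 0 ≤ s) (ht : 0 ≤ t) (hst : s + t = dist f g) :
    IsExtremal fun x => max (f x - s) (g x - t) := by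
  -- the ends of the segment are symmetric, so one case of extremality suffices
  have key : ∀ (f g : TightSpan X) {s t : ℝ}, 0 ≤ s → 0 ≤ t → s + t = dist f g →
      ∀ x, g x - t ≤ f x - s → ∀ ε > 0,
        ∃ y, (f x - s) + max (f y - s) (g y - t) ≤ dist x y + ε := by
    intro f g s t hs ht hst x hx ε hε
    rcases hs.eq_or_lt with rfl | hs
    · obtain ⟨y, hy⟩ := f.exists_add_le x hε
      refine ⟨y, ?_⟩
      have := (abs_le.1 (abs_sub_le_dist f g y)).1
      rw [max_eq_left (by linarith)]
      linarith
    -- Seen from `g`, the point `y` lies almost behind `f`. An error of at most `s` rules out the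
    -- second alternative of the four-point inequality below.
    obtain ⟨y, z, hyz⟩ := exists_dist_le f g (lt_min hε hs)
    have h₁ := min_le_left ε s
    have h₂ := min_le_right ε s
    have h₃ := g.dist_le_add y z
    have h₄ := (abs_le.1 (abs_sub_le_dist f g y)).1
    refine ⟨y, ?_⟩
    rw [max_eq_right (by linarith)]
    have H := four_point hX (of x) f (of y) g
    rw [dist_comm f (of y)] at H
    simp only [dist_of_left, of_apply, dist_comm y x] at H
    rcases le_max_iff.1 H with H | H
    · linarith
    · linarith
  refine ⟨fun x y => ?_, fun x ε hε => ?_⟩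
  · have H := four_point hX (of x) (of y) f g
    simp only [dist_of_left, of_apply, dist_comm y x] at H
    have h₁ := le_max_left (f x - s) (g x - t)
    have h₂ := le_max_right (f x - s) (g x - t)
    have h₃ := le_max_left (f y - s) (g y - t)
    have h₄ := le_max_right (f y - s) (g y - t)
    rcases le_max_iff.1 H with H | H <;> dsimp only <;> linarith
  · rcases le_total (g x - t) (f x - s) with hx | hx
    · simpa [max_eq_left hx] using key f g hs ht hst x hx ε hε
    · obtain ⟨y, hy⟩ := key g f ht hs (by rw [dist_comm, ← hst, add_comm]) x hx ε hε
      exact ⟨y, by simpa [max_eq_right hx, max_comm] using hy⟩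

/-- The tight span of a `0`-hyperbolic space is an `ℝ`-tree. -/
theorem isRTree (hX : ∀ x y z w : X,
    dist x y + dist z w ≤ max (dist x z + dist y w) (dist x w + dist y z)) :
    IsRTree (TightSpan X) where
  nonempty := ⟨of (Classical.arbitrary X)⟩
  four_point := four_point hX
  geodesic f g := by
    classical
    have hext : ∀ s ∈ Set.Icc 0 (dist f g),
        IsExtremal fun x => max (f x - s) (g x - (dist f g - s)) := fun s hs =>
      isExtremal_max_sub hX f g hs.1 (sub_nonneg.2 hs.2) (by ring)
    let γ : ℝ → TightSpan X := fun s =>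
      if hs : s ∈ Set.Icc 0 (dist f g) then ⟨_, hext s hs⟩ else f
    have hγ : ∀ s ∈ Set.Icc 0 (dist f g), ∀ x,
        γ s x = max (f x - s) (g x - (dist f g - s)) := by
      intro s hs x
      have : γ s = ⟨_, hext s hs⟩ := dif_pos hs
      rw [this]
    have h0 : γ 0 = f := by
      ext x
      have := (abs_le.1 (abs_sub_le_dist f g x)).1
      rw [hγ 0 ⟨le_rfl, dist_nonneg⟩, max_eq_left (by linarith), sub_zero]
    have h1 : γ (dist f g) = g := by
      ext x
      have := (abs_le.1 (abs_sub_le_dist f g x)).2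
      rw [hγ _ ⟨dist_nonneg, le_rfl⟩, max_eq_right (by linarith), sub_self, sub_zero]
    have hle : ∀ s ∈ Set.Icc 0 (dist f g), ∀ t ∈ Set.Icc 0 (dist f g),
        dist (γ s) (γ t) ≤ |s - t| := by
      intro s hs t ht
      refine dist_le_of_forall_abs_sub_le fun x => ?_
      rw [hγ s hs, hγ t ht]
      refine (abs_max_sub_max_le_max _ _ _ _).trans (max_le (le_of_eq ?_) (le_of_eq ?_))
      · rw [abs_sub_comm s t]; congr 1; ring
      · congr 1; ring
    -- A 1-Lipschitz path of duration `dist f g` from `f` to `g` cannot lose length anywhere.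
    have hge : ∀ s ∈ Set.Icc 0 (dist f g), ∀ t ∈ Set.Icc 0 (dist f g), s ≤ t →
        dist (γ s) (γ t) = |s - t| := by
      intro s hs t ht hst
      refine (hle s hs t ht).antisymm ?_
      have h₁ := hle 0 ⟨le_rfl, dist_nonneg⟩ s hs
      have h₂ := hle t ht (dist f g) ⟨dist_nonneg, le_rfl⟩
      rw [h0, zero_sub, abs_neg, abs_of_nonneg hs.1] at h₁
      rw [h1, abs_of_nonpos (by linarith [ht.2])] at h₂
      rw [abs_of_nonpos (by linarith)]
      linarith [dist_triangle4 f (γ s) (γ t) g]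
    refine ⟨γ, h0, h1, fun s hs t ht => ?_⟩
    rcases le_total s t with h | h
    · exact hge s hs t ht h
    · rw [dist_comm, abs_sub_comm]
      exact hge t ht s hs h

end Nonempty

section Action

variable {G : Type} [Group G] [MulAction G X] [IsIsometricSMul G X]

instance : MulAction G (TightSpan X) where
  smul g f := ⟨fun x => f (g⁻¹ • x), fun x y => by
      rw [← dist_smul g⁻¹ x y]
      exact f.dist_le_add _ _, fun x ε hε => by
      obtain ⟨y, hy⟩ := f.exists_add_le (g⁻¹ • x) hε
      refine ⟨g • y, ?_⟩
      simpa only [← dist_smul g⁻¹ x (g • y), inv_smul_smul] using hy⟩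
  one_smul f := by
    ext x
    change f ((1 : G)⁻¹ • x) = f x
    simp
  mul_smul g h f := by
    ext x
    change f ((g * h)⁻¹ • x) = f (h⁻¹ • g⁻¹ • x)
    simp [mul_smul]

theorem smul_apply (g : G) (f : TightSpan X) (x : X) : (g • f) x = f (g⁻¹ • x) := rfl

theorem dist_smul_smul (g : G) (f h : TightSpan X) : dist (g • f) (g • h) = dist f h :=
  (MulAction.toPerm g⁻¹ : X ≃ X).iSup_congr fun _ => rfl

theorem smul_of (g : G) (x : X) : g • of x = of (g • x) := by
  ext y
  rw [smul_apply, of_apply, of_apply, ← dist_smul g x, smul_inv_smul]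

end Action

end TightSpan

/-! ### Axes and minimal subtrees -/

section Axis

variable {T G : Type} [MetricSpace T] [Group G] [MulAction G T]

/-- `p` lies on the axis of `g`, on which `g` translates by `l`. -/
def IsAxisPoint (g : G) (l : ℝ) (p : T) : Prop := ∀ n : ℕ, dist p (g ^ n • p) = n * l

/-- Going from `p` to `g ^ n • p` through `x` gives `n * l ≤ 2 * dist p x + n * dist x (g • x)`; let
`n` grow. -/
theorem IsAxisPoint.le_dist_smul (hiso : ∀ (g : G) (x y : T), dist (g • x) (g • y) = dist x y)
    {g : G} {l : ℝ} {p : T} (hp : IsAxisPoint g l p) (x : T) : l ≤ dist x (g • x) := by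
  have hx : ∀ n : ℕ, dist x (g ^ n • x) ≤ n * dist x (g • x) := by
    intro n
    induction n with
    | zero => simp
    | succ n ih =>
      have h₁ := dist_triangle x (g ^ n • x) (g ^ (n + 1) • x)
      rw [pow_succ, mul_smul, hiso] at h₁
      rw [pow_succ, mul_smul]
      push_cast
      linarith
  by_contra! h
  obtain ⟨n, hn⟩ := exists_nat_gt (2 * dist p x / (l - dist x (g • x)))
  rw [div_lt_iff₀ (by linarith)] at hn
  have h₁ := dist_triangle4 p x (g ^ n • x) (g ^ n • p)
  rw [hiso, hp n, dist_comm x p] at h₁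
  linarith [hx n]

/-- In a `0`-hyperbolic space, an invariant subtree contains every axis. -/
theorem IsAxisPoint.mem_of_isSubtree (hT : ∀ x y z w : T,
      dist x y + dist z w ≤ max (dist x z + dist y w) (dist x w + dist y z))
    (hiso : ∀ (g : G) (x y : T), dist (g • x) (g • y) = dist x y)
    {g : G} {l : ℝ} {p : T} (hl : 0 < l) (hp : IsAxisPoint g l p)
    {S : Set T} (hS : IsSubtree S) (hgS : ∀ h : G, ∀ x ∈ S, h • x ∈ S) : p ∈ S := by
  obtain ⟨q, hq⟩ := hS.1
  -- The point `p` is the midpoint of `u⁻¹ • p` and `u • p`. For `n` this large, replacing these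
  -- ends by `u⁻¹ • q` and `u • q`, one at a time, keeps `p` on the segment.
  obtain ⟨n, hn⟩ := exists_nat_gt (2 * dist p q / l)
  rw [div_lt_iff₀ hl] at hn
  set u := g ^ n with hu
  have h₁ : dist p (u • p) = n * l := hp n
  have h₂ : dist (u⁻¹ • p) p = n * l := by rw [← hiso u, smul_inv_smul, h₁]
  have h₃ : dist (u⁻¹ • p) (u • p) = 2 * (n * l) := by
    rw [← hiso u, smul_inv_smul, ← mul_smul, hu, ← pow_add, hp]
    push_cast
    ring
  have h₄ : dist (u • q) (u • p) = dist p q := by rw [hiso, dist_comm]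
  have h₅ : dist (u⁻¹ • p) (u⁻¹ • q) = dist p q := hiso _ _ _
  refine hS.2 (u⁻¹ • q) (hgS _ _ hq) (u • q) (hgS _ _ hq) p (le_antisymm ?_ (dist_triangle _ _ _))
  have H₁ := hT (u⁻¹ • p) (u • p) (u⁻¹ • q) p
  have H₂ := hT (u⁻¹ • q) (u • p) (u • q) p
  rw [h₃] at H₁
  rw [dist_comm (u • p) (u⁻¹ • q), dist_comm (u • p) p, dist_comm (u⁻¹ • q) p] at H₁
  rw [dist_comm (u • p) p, dist_comm (u • p) (u • q), dist_comm (u⁻¹ • q) p,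
    dist_comm (u • q) p] at H₂
  rw [dist_comm (u⁻¹ • q) p]
  have h₇ := dist_triangle p (u⁻¹ • q) (u⁻¹ • p)
  have h₈ : 0 ≤ dist p (u • q) := dist_nonneg
  rw [dist_comm (u⁻¹ • q) (u⁻¹ • p)] at h₇
  rw [dist_comm p (u⁻¹ • p)] at h₇
  have h₉ : 0 ≤ dist p q := dist_nonneg
  rcases le_max_iff.1 H₁ with H₁ | H₁ <;> rcases le_max_iff.1 H₂ with H₂ | H₂ <;> linarith

end Axis

section MinimalSubtree

/-- The intersection of all invariant subtrees. -/
def minimalSubtree (G T : Type) [MetricSpace T] [Group G] [MulAction G T] : Set T :=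
  {x | ∀ S : Set T, IsSubtree S → (∀ g : G, ∀ y ∈ S, g • y ∈ S) → x ∈ S}

section

variable {G T : Type} [MetricSpace T] [Group G] [MulAction G T]

theorem smul_mem_minimalSubtree (g : G)
    {x : T} (hx : x ∈ minimalSubtree G T) : g • x ∈ minimalSubtree G T :=
  fun S hS hgS => hgS g x (hx S hS hgS)

instance minimalSubtree.mulAction :
    MulAction G (minimalSubtree G T) where
  smul g x := ⟨g • x.1, smul_mem_minimalSubtree g x.2⟩
  one_smul x := Subtype.ext (one_smul G x.1)
  mul_smul g h x := Subtype.ext (mul_smul g h x.1)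

theorem minimalSubtree.coe_smul (g : G)
    (x : minimalSubtree G T) : ((g • x : minimalSubtree G T) : T) = g • (x : T) := rfl

end

variable {N : ℕ} {T : Type} [MetricSpace T] [MulAction (FreeGroup (Fin N)) T]

/-- The restriction to the minimal subtree of an isometric action of a free group on an `ℝ`-tree
all of whose nontrivial elements translate an axis by at least `1`. -/
def TreeAction.ofAxes (hN : N ≠ 0) (hT : IsRTree T)
    (hiso : ∀ (g : FreeGroup (Fin N)) (x y : T), dist (g • x) (g • y) = dist x y)
    (haxis : ∀ g : FreeGroup (Fin N), g ≠ 1 → ∃ l : ℝ, 1 ≤ l ∧ ∃ p : T, IsAxisPoint g l p) :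
    TreeAction N where
  carrier := minimalSubtree (FreeGroup (Fin N)) T
  isRTree :=
    { nonempty := by
        obtain ⟨l, hl, p, hp⟩ := haxis (FreeGroup.of ⟨0, hN.bot_lt⟩) (FreeGroup.of_ne_one _)
        exact ⟨⟨p, fun S hS hgS =>
          hp.mem_of_isSubtree hT.four_point hiso (by linarith) hS hgS⟩⟩
      geodesic := by
        intro x y
        obtain ⟨γ, h0, h1, hγ⟩ := hT.geodesic x y
        have hmem : ∀ s ∈ Set.Icc 0 (dist x y), γ s ∈ minimalSubtree (FreeGroup (Fin N)) T := by
          intro s hs S hS hgS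
          refine hS.2 x (x.2 S hS hgS) y (y.2 S hS hgS) (γ s) ?_
          have hd : 0 ≤ dist (x : T) y := dist_nonneg
          have h₁ := hγ 0 ⟨le_rfl, hd⟩ s hs
          have h₂ := hγ s hs _ ⟨hd, le_rfl⟩
          rw [h0, zero_sub, abs_neg, abs_of_nonneg hs.1] at h₁
          rw [h1, abs_of_nonpos (sub_nonpos.2 (show s ≤ dist (x : T) y from hs.2))] at h₂
          rw [h₁, h₂]
          ring
        classical
        have hmem' : ∀ s ∈ Set.Icc 0 (dist x y),
            ((if hs : γ s ∈ minimalSubtree (FreeGroup (Fin N)) T then ⟨γ s, hs⟩ else x :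
              minimalSubtree (FreeGroup (Fin N)) T) : T) = γ s := by
          intro s hs
          rw [dif_pos (hmem s hs)]
        refine ⟨fun s => if hs : γ s ∈ minimalSubtree (FreeGroup (Fin N)) T then ⟨γ s, hs⟩ else x,
          Subtype.ext ?_, Subtype.ext ?_, fun s hs t ht => ?_⟩
        · rw [hmem' 0 ⟨le_rfl, dist_nonneg⟩, h0]
        · rw [hmem' _ ⟨dist_nonneg, le_rfl⟩, Subtype.dist_eq, h1]
        · rw [Subtype.dist_eq, hmem' s hs, hmem' t ht]
          exact hγ s hs t ht
      four_point := fun x y z w => hT.four_point x y z w }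
  isometric g x y := hiso g x y
  free g x h := by
    by_contra hg
    obtain ⟨l, hl, p, hp⟩ := haxis g hg
    have h₁ := hp.le_dist_smul hiso (x : T)
    rw [← minimalSubtree.coe_smul, h, dist_self] at h₁
    linarith
  minimal S hS hgS := by
    refine Set.eq_univ_of_forall fun x => ?_
    -- The image of `S` is an invariant subtree of `T`, hence contains the whole intersection.
    have hx := x.2 (Subtype.val '' S) ⟨hS.1.image _, ?_⟩ ?_
    · obtain ⟨y, hy, hyx⟩ := hx
      rwa [← Subtype.ext hyx]
    · rintro _ ⟨y, hy, rfl⟩ _ ⟨z, hz, rfl⟩ w hw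
      have hwm : w ∈ minimalSubtree (FreeGroup (Fin N)) T := fun S' hS' hgS' =>
        hS'.2 y (y.2 S' hS' hgS') z (z.2 S' hS' hgS') w hw
      exact ⟨⟨w, hwm⟩, hS.2 y hy z hz ⟨w, hwm⟩ hw, rfl⟩
    · rintro g _ ⟨y, hy, rfl⟩
      exact ⟨g • y, hgS g y hy, rfl⟩
  discrete x := by
    -- Displacements of nontrivial elements are at least 1, so orbits are uniformly separated.
    refine DiscreteTopology.of_forall_le_dist one_pos ?_
    rintro ⟨_, g, rfl⟩ ⟨_, h, rfl⟩ hne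
    have hgh : g⁻¹ * h ≠ 1 := by
      rintro h1
      rw [inv_mul_eq_one.1 h1] at hne
      exact hne rfl
    obtain ⟨l, hl, p, hp⟩ := haxis _ hgh
    have h₁ := hp.le_dist_smul hiso (x : T)
    rw [← hiso g, mul_smul, smul_inv_smul] at h₁
    exact hl.trans h₁

theorem TreeAction.translationLength_ofAxes (hN : N ≠ 0) (hT : IsRTree T)
    (hiso : ∀ (g : FreeGroup (Fin N)) (x y : T), dist (g • x) (g • y) = dist x y)
    (haxis : ∀ g : FreeGroup (Fin N), g ≠ 1 → ∃ l : ℝ, 1 ≤ l ∧ ∃ p : T, IsAxisPoint g l p)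
    {g : FreeGroup (Fin N)} {l : ℝ} (hl : 0 < l) {p : T} (hp : IsAxisPoint g l p) :
    (TreeAction.ofAxes hN hT hiso haxis).translationLength g = l := by
  have hpm : p ∈ minimalSubtree (FreeGroup (Fin N)) T := fun S hS hgS =>
    hp.mem_of_isSubtree hT.four_point hiso hl hS hgS
  let q : (TreeAction.ofAxes hN hT hiso haxis).carrier := ⟨p, hpm⟩
  have hle : ∀ x : (TreeAction.ofAxes hN hT hiso haxis).carrier, l ≤ dist x (g • x) :=
    fun x => hp.le_dist_smul hiso x.1
  have : Nonempty (TreeAction.ofAxes hN hT hiso haxis).carrier := ⟨q⟩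
  refine le_antisymm ?_ (le_ciInf hle)
  refine (ciInf_le ⟨l, Set.forall_mem_range.2 hle⟩ q).trans (le_of_eq ?_)
  have := hp 1
  rw [pow_one, Nat.cast_one, one_mul] at this
  exact this

end MinimalSubtree

/-! ### The Cayley tree of a free group -/

/-- The length of the longest common prefix of two lists. -/
def List.commonPrefixLength {β : Type} [DecidableEq β] : List β → List β → ℕ
  | a :: u, b :: v => if a = b then commonPrefixLength u v + 1 else 0
  | _, _ => 0

/-- This ultrametric inequality is the source of 0-hyperbolicity of the free group. -/
theorem List.min_commonPrefixLength_le {β : Type} [DecidableEq β] (u v w : List β) :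
    min (u.commonPrefixLength v) (v.commonPrefixLength w) ≤ u.commonPrefixLength w := by
  induction u generalizing v w with
  | nil => simp [commonPrefixLength]
  | cons a u ih =>
    rcases v with _ | ⟨b, v⟩
    · simp [commonPrefixLength]
    rcases w with _ | ⟨c, w⟩
    · simp [commonPrefixLength]
    have := ih v w
    simp only [commonPrefixLength]
    split_ifs with h₁ h₂ h₃ h₄ <;> grind

theorem List.commonPrefixLength_comm {β : Type} [DecidableEq β] (u v : List β) :
    u.commonPrefixLength v = v.commonPrefixLength u := by
  induction u generalizing v with
  | nil => cases v <;> simp [commonPrefixLength]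
  | cons a u ih =>
    rcases v with _ | ⟨b, v⟩
    · simp [commonPrefixLength]
    · simp only [commonPrefixLength, eq_comm (a := b), ih v]

namespace FreeGroup

variable {α : Type} [DecidableEq α]

theorem IsReduced.norm_mk {L : List (α × Bool)} (hL : IsReduced L) : (mk L).norm = L.length := by
  rw [norm, toWord_mk, hL.reduce_eq]

theorem IsReduced.invRev {L : List (α × Bool)} (hL : IsReduced L) : IsReduced (invRev L) := by
  rw [isReduced_iff_reduce_eq, reduce_invRev, hL.reduce_eq]

/-- Exactly the common prefix cancels in `u⁻¹v`, so its length is the Gromov product based at the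
identity. -/
theorem norm_inv_mk_mul_mk {u v : List (α × Bool)} (hu : IsReduced u) (hv : IsReduced v) :
    ((mk u)⁻¹ * mk v).norm + 2 * u.commonPrefixLength v = u.length + v.length := by
  induction u generalizing v with
  | nil => simp [List.commonPrefixLength, ← one_eq_mk, hv.norm_mk]
  | cons a u ih =>
    rcases v with _ | ⟨b, v⟩
    · simp only [← one_eq_mk, mul_one, norm_inv_eq, hu.norm_mk]
      simp [List.commonPrefixLength]
    by_cases hab : a = b
    · subst hab
      have h := ih (List.IsChain.tail hu) (List.IsChain.tail hv)
      have hcons : ∀ L : List (α × Bool), mk (a :: L) = mk [a] * mk L := fun L => by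
        rw [mul_mk, List.singleton_append]
      rw [hcons u, hcons v, mul_inv_rev, mul_assoc, inv_mul_cancel_left]
      simp only [List.tail_cons] at h
      simp only [List.commonPrefixLength, if_true, List.length_cons]
      omega
    · have : IsReduced (FreeGroup.invRev (a :: u) ++ b :: v) := by
        refine List.isChain_append.2 ⟨hu.invRev, hv, ?_⟩
        obtain ⟨a₁, a₂⟩ := a
        obtain ⟨b₁, b₂⟩ := b
        simp only [FreeGroup.invRev, List.map_cons, List.reverse_cons, List.getLast?_append,
          List.head?_cons]
        intro x hx y hy hxy
        simp at hx hy
        subst hx hy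
        cases a₂ <;> cases b₂ <;> simp_all
      rw [inv_mk, mul_mk, this.norm_mk]
      simp [List.commonPrefixLength, hab]

theorem isConj_mk_reduceCyclically (g : FreeGroup α) :
    IsConj (mk (reduceCyclically g.toWord)) g := by
  refine isConj_iff.2 ⟨mk (reduceCyclically.conjugator g.toWord), ?_⟩
  rw [inv_mk, mul_mk, mul_mk, reduceCyclically.conj_conjugator_reduceCyclically, mk_toWord]

/-- A vertex of the Cayley tree of the free group. -/
structure CayleyVertex (α : Type) : Type where
  /-- the group element labelling the vertex -/
  elem : FreeGroup α

instance : Nonempty (CayleyVertex α) := ⟨⟨1⟩⟩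

instance : MulAction (FreeGroup α) (CayleyVertex α) where
  smul g x := ⟨g * x.elem⟩
  one_smul x := congrArg CayleyVertex.mk (one_mul x.elem)
  mul_smul g h x := congrArg CayleyVertex.mk (mul_assoc g h x.elem)

instance : MetricSpace (CayleyVertex α) where
  dist x y := ((x.elem⁻¹ * y.elem).norm : ℝ)
  dist_self x := by simp
  dist_comm x y := by rw [← norm_inv_eq, mul_inv_rev, inv_inv]
  dist_triangle x y z := by
    have := norm_mul_le (x.elem⁻¹ * y.elem) (y.elem⁻¹ * z.elem)
    rw [mul_assoc, mul_inv_cancel_left] at this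
    exact_mod_cast this
  eq_of_dist_eq_zero {x y} h := by
    rw [Nat.cast_eq_zero, norm_eq_zero] at h
    exact congrArg CayleyVertex.mk (inv_mul_eq_one.1 h)

theorem CayleyVertex.dist_def (x y : CayleyVertex α) :
    dist x y = ((x.elem⁻¹ * y.elem).norm : ℝ) := rfl

theorem CayleyVertex.elem_smul {α : Type} (g : FreeGroup α) (x : CayleyVertex α) :
    (g • x).elem = g * x.elem := rfl

instance : IsIsometricSMul (FreeGroup α) (CayleyVertex α) :=
  ⟨fun g => Isometry.of_dist_eq fun x y => by
    simp only [CayleyVertex.dist_def, CayleyVertex.elem_smul, mul_inv_rev, mul_assoc,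
      inv_mul_cancel_left]⟩

/-- Translating `w` to the identity leaves the ultrametric inequality for common prefixes. -/
theorem CayleyVertex.four_point (x y z w : CayleyVertex α) :
    dist x y + dist z w ≤ max (dist x z + dist y w) (dist x w + dist y z) := by
  have base : ∀ x y z : FreeGroup α, (x⁻¹ * y).norm + z.norm ≤
      max ((x⁻¹ * z).norm + y.norm) (x.norm + (y⁻¹ * z).norm) := by
    intro x y z
    have key : ∀ x y : FreeGroup α, (x⁻¹ * y).norm +
        2 * x.toWord.commonPrefixLength y.toWord = x.norm + y.norm := by
      intro x y
      have := norm_inv_mk_mul_mk (u := x.toWord) (v := y.toWord) isReduced_toWord isReduced_toWord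
      rwa [mk_toWord, mk_toWord] at this
    have h₁ := key x y
    have h₂ := key x z
    have h₃ := key y z
    have h₄ := List.min_commonPrefixLength_le x.toWord z.toWord y.toWord
    rw [List.commonPrefixLength_comm z.toWord] at h₄
    omega
  have key := base (w.elem⁻¹ * x.elem) (w.elem⁻¹ * y.elem) (w.elem⁻¹ * z.elem)
  simp only [mul_inv_rev, inv_inv, mul_assoc, mul_inv_cancel_left] at key
  rw [dist_comm z w, dist_comm y w, dist_comm x w]
  simp only [CayleyVertex.dist_def]
  exact_mod_cast key

/-- The Cayley tree of the free group, with the action of `G` through `φ`. -/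
def CayleyTree {G : Type} [Group G] (_φ : G →* FreeGroup α) : Type := TightSpan (CayleyVertex α)

namespace CayleyTree

variable {G : Type} [Group G] (φ : G →* FreeGroup α)

noncomputable instance : MetricSpace (CayleyTree φ) :=
  inferInstanceAs (MetricSpace (TightSpan (CayleyVertex α)))

instance : MulAction G (CayleyTree φ) :=
  MulAction.compHom (TightSpan (CayleyVertex α)) φ

theorem isRTree : IsRTree (CayleyTree φ) := TightSpan.isRTree CayleyVertex.four_point

theorem dist_smul_smul (g : G) (x y : CayleyTree φ) : dist (g • x) (g • y) = dist x y :=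
  TightSpan.dist_smul_smul (φ g) _ _

/-- The point of the Cayley tree given by an element of the free group. -/
def vertex (k : FreeGroup α) : CayleyTree φ :=
  (TightSpan.of (CayleyVertex.mk k) : TightSpan (CayleyVertex α))

theorem dist_vertex_smul (g : G) (k : FreeGroup α) :
    dist (vertex φ k) (g • vertex φ k) = ((k⁻¹ * (φ g * k)).norm : ℝ) := by
  have h : dist (TightSpan.of (CayleyVertex.mk k)) (φ g • TightSpan.of (CayleyVertex.mk k)) =
      ((k⁻¹ * (φ g * k)).norm : ℝ) := by
    rw [TightSpan.smul_of, TightSpan.dist_of_of, CayleyVertex.dist_def, CayleyVertex.elem_smul]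
  exact h

/-- Powers of a cyclically reduced word do not cancel, so the vertex at the conjugating element lies
on the axis. -/
theorem exists_isAxisPoint {g : G} {L : List (α × Bool)} (hL : IsCyclicallyReduced L)
    (hg : IsConj (mk L) (φ g)) : ∃ p : CayleyTree φ, IsAxisPoint g L.length p := by
  obtain ⟨k, hk⟩ := isConj_iff.1 hg
  refine ⟨vertex φ k, fun n => ?_⟩
  have : k⁻¹ * (φ (g ^ n) * k) = mk L ^ n := by
    rw [_root_.map_pow, ← hk, conj_pow]
    simp only [mul_assoc, inv_mul_cancel, inv_mul_cancel_left, mul_one]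
  rw [dist_vertex_smul, this, norm, toWord_pow, toWord_mk, hL.isReduced.reduce_eq,
    (hL.flatten_replicate n).isReduced.reduce_eq]
  simp

theorem exists_axis (hφ : Function.Injective φ) (g : G) (hg : g ≠ 1) :
    ∃ l : ℝ, 1 ≤ l ∧ ∃ p : CayleyTree φ, IsAxisPoint g l p := by
  have hL : IsCyclicallyReduced (reduceCyclically (φ g).toWord) :=
    reduceCyclically.isCyclicallyReduced isReduced_toWord
  have hc := isConj_mk_reduceCyclically (φ g)
  refine ⟨_, ?_, exists_isAxisPoint φ hL hc⟩
  rw [Nat.one_le_cast, Nat.one_le_iff_ne_zero, Ne, List.length_eq_zero_iff]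
  intro h
  rw [h, ← one_eq_mk, isConj_one_right] at hc
  exact hg (hφ (hc.trans (_root_.map_one φ).symm))

end CayleyTree

end FreeGroup

namespace FreeGroup

variable {α β : Type}

/-! ### Substitution of words for letters -/

/-- The word obtained from `L` by substituting the word `s i` for the letter `i`. -/
def substWord (s : α → List (β × Bool)) (L : List (α × Bool)) : List (β × Bool) :=
  L.flatMap fun x => cond x.2 (s x.1) (invRev (s x.1))

theorem lift_mk_substWord (s : α → List (β × Bool)) (L : List (α × Bool)) :
    lift (fun i => mk (s i)) (mk L) = mk (substWord s L) := by
  induction L with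
  | nil => simp [substWord, ← one_eq_mk]
  | cons x L ih =>
    have : mk (x :: L) = mk [x] * mk L := by rw [mul_mk, List.singleton_append]
    rw [this, _root_.map_mul, ih, substWord, substWord, List.flatMap_cons, ← mul_mk]
    congr 1
    rcases x with ⟨i, _ | _⟩ <;> simp [inv_mk]

theorem length_substWord (s : α → List (β × Bool)) (L : List (α × Bool)) :
    (substWord s L).length = (L.map fun x => (s x.1).length).sum := by
  rw [substWord, List.length_flatMap]
  congr 2
  funext x
  rcases x with ⟨i, _ | _⟩ <;> simp

theorem substWord_ne_nil {s : α → List (β × Bool)} (hs : ∀ i, s i ≠ []) {L : List (α × Bool)}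
    (hL : L ≠ []) : substWord s L ≠ [] := by
  obtain ⟨x, L, rfl⟩ := List.exists_cons_of_ne_nil hL
  rw [← List.length_pos_iff, length_substWord, List.map_cons, List.sum_cons]
  exact Nat.add_pos_left (List.length_pos_iff.2 (hs x.1)) _

/-- The blocks are reduced and nonempty, so cancellation can start only where consecutive blocks
meet. The relation `R` may be stricter than mere absence of cancellation in `L`. -/
theorem isReduced_substWord [DecidableEq β] {s : α → List (β × Bool)}
    {R : α × Bool → α × Bool → Prop}
    (hs : ∀ i, s i ≠ []) (hred : ∀ i, IsReduced (s i))
    (hR : ∀ x y, R x y → ∀ a ∈ (cond x.2 (s x.1) (invRev (s x.1))).getLast?,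
      ∀ b ∈ (cond y.2 (s y.1) (invRev (s y.1))).head?, a.1 = b.1 → a.2 = b.2)
    {L : List (α × Bool)} (hL : L.IsChain R) : IsReduced (substWord s L) := by
  rw [substWord, List.flatMap_def, IsReduced, List.isChain_flatten]
  · refine ⟨?_, ?_⟩
    · intro l hl
      obtain ⟨⟨i, e⟩, -, rfl⟩ := List.mem_map.1 hl
      cases e
      · exact (hred i).invRev
      · exact hred i
    · rw [List.isChain_map]
      exact hL.imp fun x y h => hR x y h
  · intro h
    obtain ⟨⟨i, e⟩, -, h⟩ := List.mem_map.1 h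
    have hlen := congrArg List.length h
    cases e <;> simp at hlen <;> exact hs i hlen

/-- In the doubled word, the middle junction is the wrap-around of the cyclic word. -/
theorem isCyclicallyReduced_substWord [DecidableEq β] {s : α → List (β × Bool)}
    {R : α × Bool → α × Bool → Prop}
    (hs : ∀ i, s i ≠ []) (hred : ∀ i, IsReduced (s i))
    (hR : ∀ x y, R x y → ∀ a ∈ (cond x.2 (s x.1) (invRev (s x.1))).getLast?,
      ∀ b ∈ (cond y.2 (s y.1) (invRev (s y.1))).head?, a.1 = b.1 → a.2 = b.2)
    {L : List (α × Bool)} (hL : (L ++ L).IsChain R) : IsCyclicallyReduced (substWord s L) := by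
  have h := isReduced_substWord hs hred hR hL
  rw [substWord, List.flatMap_append] at h
  have h' := List.isChain_append.1 h
  exact ⟨h'.1, h'.2.2⟩

/-! ### A rose and a barbell -/

/-- The words `x₀` and `x₁³`. -/
def roseWord : Fin 2 → List (Fin 2 × Bool) :=
  ![[(0, true)], [(1, true), (1, true), (1, true)]]

/-- The words `x₀` and `x₁ x₀ x₁⁻¹`. -/
def barbellWord : Fin 2 → List (Fin 2 × Bool) :=
  ![[(0, true)], [(1, true), (0, true), (1, false)]]

/-- The endomorphism `x₀ ↦ x₀`, `x₁ ↦ x₁³` of `F₂`; the quotient of the minimal subtree of its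
image is a rose. -/
def roseHom : FreeGroup (Fin 2) →* FreeGroup (Fin 2) := lift fun i => mk (roseWord i)

/-- The endomorphism `x₀ ↦ x₀`, `x₁ ↦ x₁ x₀ x₁⁻¹` of `F₂`; the quotient of the minimal subtree of
its image is a barbell. -/
def barbellHom : FreeGroup (Fin 2) →* FreeGroup (Fin 2) := lift fun i => mk (barbellWord i)

theorem roseWord_ne_nil (i : Fin 2) : roseWord i ≠ [] := by fin_cases i <;> simp [roseWord]

theorem barbellWord_ne_nil (i : Fin 2) : barbellWord i ≠ [] := by
  fin_cases i <;> simp [barbellWord]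

theorem isReduced_roseWord (i : Fin 2) : IsReduced (roseWord i) := by
  fin_cases i <;> simp [roseWord, IsReduced]

theorem isReduced_barbellWord (i : Fin 2) : IsReduced (barbellWord i) := by
  fin_cases i <;> simp [barbellWord, IsReduced]

theorem length_roseWord_eq (i : Fin 2) : (roseWord i).length = (barbellWord i).length := by
  fin_cases i <;> simp [roseWord, barbellWord]

theorem roseWord_junction (x y : Fin 2 × Bool) (h : x.1 = y.1 → x.2 = y.2) :
    ∀ a ∈ (cond x.2 (roseWord x.1) (invRev (roseWord x.1))).getLast?,
      ∀ b ∈ (cond y.2 (roseWord y.1) (invRev (roseWord y.1))).head?, a.1 = b.1 → a.2 = b.2 := by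
  obtain ⟨i, e⟩ := x
  obtain ⟨j, e'⟩ := y
  fin_cases i <;> fin_cases j <;> cases e <;> cases e' <;> simp_all [roseWord, invRev]

/-- Two consecutive letters that do not cancel and are not both `x₁^{±1}`. -/
def NoSquareStep (x y : Fin 2 × Bool) : Prop := (x.1 = y.1 → x.2 = y.2) ∧ ¬(x.1 = 1 ∧ y.1 = 1)

/-- The blocks of `x₁` and of `x₁⁻¹` both begin with `x₁` and end with `x₁⁻¹`, so two of them in a
row would cancel; every other junction is harmless. -/
theorem barbellWord_junction (x y : Fin 2 × Bool) (h : NoSquareStep x y) :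
    ∀ a ∈ (cond x.2 (barbellWord x.1) (invRev (barbellWord x.1))).getLast?,
      ∀ b ∈ (cond y.2 (barbellWord y.1) (invRev (barbellWord y.1))).head?,
        a.1 = b.1 → a.2 = b.2 := by
  obtain ⟨i, e⟩ := x
  obtain ⟨j, e'⟩ := y
  unfold NoSquareStep at h
  fin_cases i <;> fin_cases j <;> cases e <;> cases e' <;> simp_all [barbellWord, invRev]

theorem roseHom_injective : Function.Injective roseHom := by
  refine (injective_iff_map_eq_one roseHom).2 fun g hg => ?_
  have hred : IsReduced (substWord roseWord g.toWord) :=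
    isReduced_substWord roseWord_ne_nil isReduced_roseWord roseWord_junction isReduced_toWord
  rw [← mk_toWord (x := g), roseHom, lift_mk_substWord] at hg
  have hnil : substWord roseWord g.toWord = [] := by
    rw [← hred.reduce_eq, ← toWord_mk, hg, toWord_one]
  by_contra hne
  exact substWord_ne_nil roseWord_ne_nil (mt toWord_eq_nil_iff.1 hne) hnil

/-- Permutations of the letters, as automorphisms of the free group. -/
def permHom (α : Type) : Equiv.Perm α →* MulAut (FreeGroup α) where
  toFun e := freeGroupCongr e
  map_one' := freeGroupCongr_refl
  map_mul' e f := by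
    ext x
    simp [freeGroupCongr_apply, FreeGroup.map.comp]

/-- Substitution may cancel here, so the argument for the rose is not available. Instead, send `x₁`
to the swap of letters in a semidirect product: conjugating `x₀` by it gives `x₁`, and the composite
is the canonical inclusion. -/
theorem barbellHom_injective : Function.Injective barbellHom := by
  let ψ : FreeGroup (Fin 2) →* FreeGroup (Fin 2) ⋊[permHom (Fin 2)] Equiv.Perm (Fin 2) :=
    lift ![SemidirectProduct.inl (of 0), SemidirectProduct.inr (Equiv.swap 0 1)]
  have hψ : ψ.comp barbellHom = SemidirectProduct.inl := by
    ext1 i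
    fin_cases i
    · simp [barbellHom, barbellWord, ψ]
    · have : barbellHom (of 1) = of 1 * of 0 * (of 1)⁻¹ := by
        simp only [barbellHom, barbellWord, lift_apply_of]
        rfl
      simp only [Fin.mk_one, MonoidHom.comp_apply, this, _root_.map_mul, _root_.map_inv]
      simp only [ψ, lift_apply_of, Matrix.cons_val_zero, Matrix.cons_val_one]
      rw [← _root_.map_inv, ← SemidirectProduct.inl_aut]
      simp [permHom]
  refine Function.Injective.of_comp (f := ψ) ?_
  rw [← MonoidHom.coe_comp, hψ]
  exact SemidirectProduct.inl_injective

end FreeGroup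

/-! ### Property `𝒲*` and the comparison of the two length functions -/

open FreeGroup

theorem isChain_noSquareStep_of_cyclicSubwords {w : List (Fin 2 × Bool)}
    (hw : IsCyclicallyReduced w) (hpow : mk w ∉ Subgroup.zpowers (of (1 : Fin 2)))
    (hsub : ∀ t : ℤ, IsCyclicSubword (toWord (of (1 : Fin 2) ^ t)) w → t = 1 ∨ t = -1) :
    (w ++ w).IsChain NoSquareStep := by
  have key : ∀ x y : Fin 2 × Bool, (x.1 = y.1 → x.2 = y.2) →
      (∃ w', w' ~r w ∧ [x, y] <:+: w') → NoSquareStep x y := by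
    rintro ⟨i, e⟩ ⟨j, e'⟩ hxy hinf
    refine ⟨hxy, ?_⟩
    rintro ⟨hi, hj⟩
    dsimp only at hi hj hxy
    subst hi hj
    obtain rfl := hxy rfl
    cases e
    · have h : toWord (of (1 : Fin 2) ^ (-2 : ℤ)) = [(1, false), (1, false)] := by
        decide
      have := hsub (-2) (by rw [h]; exact ⟨by simp, hinf⟩)
      omega
    · have h : toWord (of (1 : Fin 2) ^ (2 : ℤ)) = [(1, true), (1, true)] := by
        decide
      have := hsub 2 (by rw [h]; exact ⟨by simp, hinf⟩)
      omega
  have hchain : w.IsChain NoSquareStep := by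
    rw [List.isChain_iff_forall_rel_of_append_cons_cons]
    intro x y l₁ l₂ hl
    refine key x y ?_ ⟨w, List.IsRotated.refl w, l₁, l₂, by simp [hl]⟩
    exact List.isChain_iff_forall_rel_of_append_cons_cons.1 hw.isReduced hl
  refine List.isChain_append.2 ⟨hchain, hchain, fun x hx y hy => ?_⟩
  have hxy := hw.2 x hx y hy
  rcases List.eq_nil_or_concat w with rfl | ⟨l, x', rfl⟩
  · simp at hx
  rw [List.concat_eq_append] at *
  obtain rfl : x' = x := by simpa using hx
  rcases l with _ | ⟨y', l⟩
  -- In a one-letter word the wrap-around pair is in no rotation; condition (1) excludes the letter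
  -- `x₁^{±1}`.
  · obtain rfl : x' = y := by simpa using hy
    refine ⟨hxy, fun h => hpow ?_⟩
    obtain ⟨i, e⟩ := x'
    obtain rfl : i = 1 := h.1
    cases e
    · exact Subgroup.inv_mem_iff _ |>.1 (Subgroup.mem_zpowers (of (1 : Fin 2)))
    · exact Subgroup.mem_zpowers (of (1 : Fin 2))
  · obtain rfl : y' = y := by simpa using hy
    exact key x' y' hxy ⟨[x'] ++ (y' :: l), List.isRotated_append, [], l, by simp⟩

/-- The action of `F₂` on the minimal subtree of the Cayley tree determined by an injective
endomorphism. -/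
noncomputable def cayleyTreeAction (φ : FreeGroup (Fin 2) →* FreeGroup (Fin 2))
    (hφ : Function.Injective φ) : TreeAction 2 :=
  TreeAction.ofAxes two_ne_zero (CayleyTree.isRTree φ) (CayleyTree.dist_smul_smul φ)
    (CayleyTree.exists_axis φ hφ)

theorem translationLength_cayleyTreeAction (φ : FreeGroup (Fin 2) →* FreeGroup (Fin 2))
    (hφ : Function.Injective φ) {g : FreeGroup (Fin 2)} {L : List (Fin 2 × Bool)}
    (hL : IsCyclicallyReduced L) (hnil : L ≠ []) (hg : IsConj (mk L) (φ g)) :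
    (cayleyTreeAction φ hφ).translationLength g = L.length := by
  obtain ⟨p, hp⟩ := CayleyTree.exists_isAxisPoint φ hL hg
  exact TreeAction.translationLength_ofAxes _ _ _ _
    (Nat.cast_pos.2 (List.length_pos_iff.2 hnil)) hp

theorem mainTheorem7 (S : Set (FreeGroup (Fin 2))) (hS : PropertyWStar S) :
    ¬ SpectrallyRigid S := by
  obtain ⟨B, k, -, hB⟩ := hS
  set C := twistBasis B k
  have hrose : Function.Injective (roseHom.comp C.repr.toMonoidHom) :=
    roseHom_injective.comp C.repr.injective
  have hbarbell : Function.Injective (barbellHom.comp C.repr.toMonoidHom) :=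
    barbellHom_injective.comp C.repr.injective
  intro hrigid
  have hT := hrigid (Quotient.mk _ (cayleyTreeAction _ hrose))
    (Quotient.mk _ (cayleyTreeAction _ hbarbell)) fun σ hσ => ?_
  -- The element `ba^k` tells the trees apart: its length is 3 in the rose, and 1 in the barbell,
  -- where its image is conjugate to `x₀`.
  · have hlen := congrFun (congrArg OuterSpace.translationLength hT) (C 1)
    change (cayleyTreeAction _ hrose).translationLength (C 1) =
      (cayleyTreeAction _ hbarbell).translationLength (C 1) at hlen
    have hC : C.repr (C 1) = of 1 := C.repr_apply_coe 1
    rw [translationLength_cayleyTreeAction _ hrose (L := [(1, true), (1, true), (1, true)])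
        (by simp [IsCyclicallyReduced, FreeGroup.IsReduced]) (by simp) ?_,
      translationLength_cayleyTreeAction _ hbarbell (L := [(0, true)])
        IsCyclicallyReduced.singleton (by simp) ?_] at hlen
    · norm_num at hlen
    · refine isConj_iff.2 ⟨of 1, ?_⟩
      change _ = barbellHom (C.repr (C 1))
      rw [hC, barbellHom, lift_apply_of]
      rfl
    · change IsConj _ (roseHom (C.repr (C 1)))
      rw [hC, roseHom, lift_apply_of]
      exact IsConj.refl _
  · obtain ⟨hpow, hsub⟩ := hB σ hσ
    have hw : IsCyclicallyReduced (cyclicWord C σ) :=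
      reduceCyclically.isCyclicallyReduced isReduced_toWord
    have hconj : IsConj (mk (cyclicWord C σ)) (C.repr σ) := isConj_mk_reduceCyclically _
    have hnil : cyclicWord C σ ≠ [] := by
      intro h
      rw [h, ← one_eq_mk] at hpow
      exact hpow (one_mem _)
    have hchain := isChain_noSquareStep_of_cyclicSubwords hw hpow hsub
    change (cayleyTreeAction _ hrose).translationLength σ =
      (cayleyTreeAction _ hbarbell).translationLength σ
    rw [translationLength_cayleyTreeAction _ hrose
        (isCyclicallyReduced_substWord roseWord_ne_nil isReduced_roseWord
          (fun x y h => roseWord_junction x y h.1) hchain) (substWord_ne_nil roseWord_ne_nil hnil) ?_,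
      translationLength_cayleyTreeAction _ hbarbell
        (isCyclicallyReduced_substWord barbellWord_ne_nil isReduced_barbellWord
          barbellWord_junction hchain) (substWord_ne_nil barbellWord_ne_nil hnil) ?_]
    · simp only [length_substWord, length_roseWord_eq]
    · rw [← lift_mk_substWord]
      exact barbellHom.map_isConj hconj
    · rw [← lift_mk_substWord]
      exact roseHom.map_isConj hconj
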